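/- Theorem 1.3. All matroids are on finite ground sets. For a matroid $M$ with ground set $E$ and rank function $r$ let $T_M(x,y)=\sum_{A\subseteq E}(x-1)^{r(E)-r(A)}(y-1)^{|A|-r(A)}$ be its Tutte polynomial. A matroid is connected if any two distinct elements of its ground set lie in a common circuit. A cyclic flat is a flat that is a (possibly empty) union of circuits. A connected split matroid is a connected matroid on a ground set $E$ such that, whenever $F_1\subsetneq F_2$ are two of its cyclic flats, $F_1=\varnothing$ or $F_2=E$. A split matroid is a matroid isomorphic to a finite direct sum in which one summand is a connected split matroid and all the other summands (if any) are uniform matroids. Let $M$ be a split matroid without loops and coloops. Then \[ T_M(2,0)\cdot T_M(0,2)\ \ge\ T_M(1,1)^2, \] and consequently also \[ T_M(2,0)+T_M(0,2)\ \ge\ 2\,T_M(1,1)\qquad\text{and}\qquad \max\bigl(T_M(2,0),\,T_M(0,2)\bigr)\ \ge\ T_M(1,1). \] -/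

import Mathlib

namespace Matroid

/-- The rank `r_M(A)` as a natural number. (For a finite matroid `M.eRk A` is finite.) -/
noncomputable def natRk {α : Type*} (M : Matroid α) (A : Set α) : ℕ := (M.eRk A).toNat

/-- The Tutte polynomial
`T_M(x, y) = ∑_{A ⊆ E} (x - 1) ^ (r(E) - r(A)) * (y - 1) ^ (|A| - r(A))`
of a finite matroid, with `x = X 0` and `y = X 1`. The exponents are never truncated, because
`r(A) ≤ r(E)` and `r(A) ≤ |A|` for `A ⊆ E`. -/
noncomputable def tuttePolynomial {α : Type*} (M : Matroid α) [M.Finite] :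
    MvPolynomial (Fin 2) ℤ :=
  ∑ A ∈ M.ground_finite.toFinset.powerset,
    (MvPolynomial.X 0 - 1) ^ (M.natRk M.E - M.natRk (A : Set α)) *
      (MvPolynomial.X 1 - 1) ^ (A.card - M.natRk (A : Set α))

/-- The value `T_M(x, y)` of the Tutte polynomial at integers `x` and `y`. -/
noncomputable def tutteEval {α : Type*} (M : Matroid α) [M.Finite] (x y : ℤ) : ℤ :=
  MvPolynomial.eval ![x, y] M.tuttePolynomial

/-- A matroid is connected if any two distinct elements of its ground set lie in a common circuit.
-/
def IsConnected {α : Type*} (M : Matroid α) : Prop :=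
  ∀ e ∈ M.E, ∀ f ∈ M.E, e ≠ f → ∃ C, M.IsCircuit C ∧ e ∈ C ∧ f ∈ C

/-- A cyclic flat is a flat that is a (possibly empty) union of circuits. -/
def IsCyclicFlat {α : Type*} (M : Matroid α) (F : Set α) : Prop :=
  M.IsFlat F ∧ ∃ 𝒞 : Set (Set α), (∀ C ∈ 𝒞, M.IsCircuit C) ∧ F = ⋃₀ 𝒞

/-- A connected split matroid: a connected matroid whose proper cyclic flats form a clutter. -/
def IsConnectedSplit {α : Type*} (M : Matroid α) : Prop :=
  M.IsConnected ∧
    ∀ F₁ F₂ : Set α, M.IsCyclicFlat F₁ → M.IsCyclicFlat F₂ → F₁ ⊂ F₂ → F₁ = ∅ ∨ F₂ = M.E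

/-- A uniform matroid: for some `k`, the independent sets are the subsets of the ground set with
at most `k` elements. -/
def IsUniform {α : Type*} (M : Matroid α) : Prop :=
  ∃ k : ℕ, ∀ I : Set α, M.Indep I ↔ I ⊆ M.E ∧ I.encard ≤ k

/-- A split matroid: a finite direct sum of a connected split matroid and of uniform matroids.
Being isomorphic to such a direct sum is the same as being the internal direct sum of matroids of
these kinds on pairwise disjoint subsets of the ground set. -/
def IsSplit {α : Type*} (M : Matroid α) : Prop :=
  ∃ (n : ℕ) (N : Fin n → Matroid α)
    (hN : Pairwise (Function.onFun Disjoint fun i ↦ (N i).E)) (i₀ : Fin n),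
    (N i₀).IsConnectedSplit ∧ (∀ i, i ≠ i₀ → (N i).IsUniform) ∧ M = Matroid.disjointSigma N hN

end Matroid

open Set

namespace Matroid

variable {α : Type*} {M N : Matroid α} {e f g s t : α} {x y : ℤ}

lemma coe_natRk (M : Matroid α) [M.RankFinite] (A : Set α) : (M.natRk A : ℕ∞) = M.eRk A :=
  ENat.natCast_toNat (M.isRkFinite_set A).eRk_lt_top.ne

lemma natRk_mono (M : Matroid α) [M.RankFinite] {A B : Set α} (h : A ⊆ B) :
    M.natRk A ≤ M.natRk B := by
  have := M.eRk_mono h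
  rw [← coe_natRk, ← coe_natRk] at this
  exact_mod_cast this

lemma natRk_le_card (M : Matroid α) [M.RankFinite] (A : Finset α) : M.natRk A ≤ A.card := by
  have := M.eRk_le_encard A
  rw [← coe_natRk, Set.encard_coe_eq_coe_finsetCard] at this
  exact_mod_cast this

/-- The summand of the set `A` in the corank-nullity sum. -/
noncomputable def tutteTerm (M : Matroid α) (x y : ℤ) (A : Finset α) : ℤ :=
  (x - 1) ^ (M.natRk M.E - M.natRk (A : Set α)) * (y - 1) ^ (A.card - M.natRk (A : Set α))

lemma tutteEval_eq_sum (M : Matroid α) [M.Finite] (x y : ℤ) :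
    M.tutteEval x y = ∑ A ∈ M.ground_finite.toFinset.powerset, M.tutteTerm x y A := by
  simp [tutteEval, tuttePolynomial, tutteTerm, map_sum]

lemma tutteEval_congr {N : Matroid α} [M.Finite] [N.Finite] (h : M = N) (x y : ℤ) :
    M.tutteEval x y = N.tutteEval x y := by
  subst h; rfl

lemma tutteEval_of_ground_eq_empty [M.Finite] (h : M.E = ∅) (x y : ℤ) : M.tutteEval x y = 1 := by
  have : M.ground_finite.toFinset = ∅ := by simp [h]
  rw [tutteEval_eq_sum, this]
  simp [tutteTerm, h]

lemma tutteEval_eq_sum_add_sum [DecidableEq α] [M.Finite] (he : e ∈ M.E) (x y : ℤ) :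
    M.tutteEval x y = ∑ A ∈ (M ＼ {e}).ground_finite.toFinset.powerset, M.tutteTerm x y A +
      ∑ A ∈ (M ＼ {e}).ground_finite.toFinset.powerset, M.tutteTerm x y (insert e A) := by
  have h : M.ground_finite.toFinset = insert e (M ＼ {e}).ground_finite.toFinset := by
    ext a; by_cases h : a = e <;> simp [h, he]
  rw [tutteEval_eq_sum, h, Finset.sum_powerset_insert (by simp)]

lemma natRk_delete_of_notMem {A : Set α} (he : e ∉ A) : (M ＼ {e}).natRk A = M.natRk A := by
  have : A ∩ (M.E \ {e}) = A ∩ M.E := by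
    ext a; simp only [mem_inter_iff, mem_sdiff, mem_singleton_iff]
    exact ⟨fun h ↦ ⟨h.1, h.2.1⟩, fun h ↦ ⟨h.1, h.2, fun h' ↦ he (h' ▸ h.1)⟩⟩
  rw [natRk, natRk, delete_eq_restrict, restrict_eRk_eq', this, eRk_inter_ground]

lemma natRk_ground_delete_of_not_isColoop (hcol : ¬ M.IsColoop e) :
    (M ＼ {e}).natRk (M ＼ {e}).E = M.natRk M.E := by
  rw [delete_ground, natRk_delete_of_notMem (by simp), natRk, natRk, eRk_ground]
  rw [isColoop_iff_sdiff_not_spanning, not_not] at hcol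
  rw [hcol.eRk_eq]

lemma IsColoop.natRk_ground [M.RankFinite] (h : M.IsColoop e) :
    M.natRk M.E = (M ＼ {e}).natRk (M ＼ {e}).E + 1 := by
  rw [delete_ground, natRk_delete_of_notMem (by simp)]
  have h1 : e ∉ M.closure (M.E \ {e}) := h.notMem_closure_of_notMem (by simp)
  have h2 := eRk_insert_eq_add_one (M := M) (e := e) (X := M.E \ {e}) ⟨h.mem_ground, h1⟩
  rw [insert_sdiff_singleton, insert_eq_of_mem h.mem_ground, ← coe_natRk, ← coe_natRk] at h2
  exact_mod_cast h2

lemma IsNonloop.natRk_insert [M.RankFinite] (h : M.IsNonloop e) {A : Set α}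
    (hA : A ⊆ (M ／ {e}).E) : M.natRk (insert e A) = (M ／ {e}).natRk A + 1 := by
  obtain ⟨I, hI⟩ := (M ／ {e}).exists_isBasis A hA
  have h1 := h.indep.union_isBasis_union_of_contract_isBasis hI
  have heI : e ∉ I := fun heI ↦ (hA (hI.subset heI)).2 rfl
  have h2 := h1.eRk_eq_encard
  rw [union_singleton, union_singleton, encard_insert_of_notMem heI, ← hI.eRk_eq_encard,
    ← coe_natRk, ← coe_natRk] at h2
  exact_mod_cast h2

lemma IsLoop.natRk_insert (h : M.IsLoop e) (A : Set α) : M.natRk (insert e A) = M.natRk A := by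
  rw [natRk, natRk, ← union_singleton, eRk_eq_eRk_union_eRk_le_zero _ h.eRk_eq.le]

lemma notMem_of_mem_powerset_delete [M.Finite] {A : Finset α}
    (hA : A ∈ (M ＼ {e}).ground_finite.toFinset.powerset) : e ∉ A := by
  rw [Finset.mem_powerset] at hA
  intro h
  simpa using hA h

/-- Deletion-contraction for the Tutte polynomial. -/
theorem tutteEval_eq_delete_add_contract [M.Finite] (he : M.IsNonloop e)
    (hcol : ¬ M.IsColoop e) (x y : ℤ) :
    M.tutteEval x y = (M ＼ {e}).tutteEval x y + (M ／ {e}).tutteEval x y := by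
  classical
  have hg := he.mem_ground
  rw [tutteEval_eq_sum_add_sum hg, tutteEval_eq_sum (M ＼ {e}), tutteEval_eq_sum (M ／ {e})]
  congr 1
  · refine Finset.sum_congr rfl fun A hA ↦ ?_
    rw [tutteTerm, tutteTerm, natRk_ground_delete_of_not_isColoop hcol, natRk_delete_of_notMem
      (by simpa using notMem_of_mem_powerset_delete hA)]
  · refine Finset.sum_congr rfl fun A hA ↦ ?_
    have hAE : (A : Set α) ⊆ (M ／ {e}).E := by simpa using hA
    have heA := notMem_of_mem_powerset_delete hA
    have hE : M.natRk M.E = (M ／ {e}).natRk (M ／ {e}).E + 1 := by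
      rw [← he.natRk_insert subset_rfl, contract_ground, insert_sdiff_singleton,
        insert_eq_of_mem hg]
    rw [tutteTerm, tutteTerm, Finset.coe_insert, he.natRk_insert hAE, hE,
      Finset.card_insert_of_notMem heA, Nat.add_sub_add_right, Nat.add_sub_add_right]

theorem IsLoop.tutteEval_eq [M.Finite] (he : M.IsLoop e) (x y : ℤ) :
    M.tutteEval x y = y * (M ＼ {e}).tutteEval x y := by
  classical
  have hg := he.mem_ground
  have hcol := he.not_isColoop
  rw [tutteEval_eq_sum_add_sum hg, tutteEval_eq_sum (M ＼ {e}), ← Finset.sum_add_distrib,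
    Finset.mul_sum]
  refine Finset.sum_congr rfl fun A hA ↦ ?_
  have heA := notMem_of_mem_powerset_delete hA
  rw [tutteTerm, tutteTerm, tutteTerm, natRk_ground_delete_of_not_isColoop hcol,
    natRk_delete_of_notMem (by simpa using heA), Finset.coe_insert, he.natRk_insert,
    Finset.card_insert_of_notMem heA, Nat.succ_sub (natRk_le_card M A), pow_succ]
  ring

theorem IsColoop.tutteEval_eq [M.Finite] (he : M.IsColoop e) (x y : ℤ) :
    M.tutteEval x y = x * (M ＼ {e}).tutteEval x y := by
  classical
  have hg := he.mem_ground
  have hc : M ／ {e} = M ＼ {e} :=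
    contract_eq_delete_of_subset_coloops (singleton_subset_iff.2 he)
  rw [tutteEval_eq_sum_add_sum hg, tutteEval_eq_sum (M ＼ {e}), ← Finset.sum_add_distrib,
    Finset.mul_sum]
  refine Finset.sum_congr rfl fun A hA ↦ ?_
  have heA := notMem_of_mem_powerset_delete hA
  have heA' : e ∉ (A : Set α) := by simpa using heA
  have hAE : (A : Set α) ⊆ (M ＼ {e}).E := by simpa using hA
  have h1 : M.natRk (insert e (A : Set α)) = M.natRk A + 1 := by
    rw [he.isNonloop.natRk_insert (by simpa [hc] using hAE), hc, natRk_delete_of_notMem heA']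
  have h2 : M.natRk A ≤ (M ＼ {e}).natRk (M ＼ {e}).E := by
    rw [← natRk_delete_of_notMem heA']
    exact natRk_mono _ hAE
  rw [tutteTerm, tutteTerm, tutteTerm, he.natRk_ground, natRk_delete_of_notMem heA',
    Finset.coe_insert, h1, Finset.card_insert_of_notMem heA, Nat.succ_sub h2, pow_succ,
    Nat.add_sub_add_right, Nat.add_sub_add_right]
  ring

theorem tutteEval_dual (M : Matroid α) [M.Finite] (x y : ℤ) :
    M✶.tutteEval x y = M.tutteEval y x := by
  classical
  have key : ∀ A : Finset α, (A : Set α) ⊆ M.E →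
      M✶.natRk A + M.natRk M.E = M.natRk (M.E \ A) + A.card := by
    intro A hA
    have h := M.eRk_dual_add_eRank A hA
    rw [← eRk_ground, encard_coe_eq_coe_finsetCard, ← coe_natRk, ← coe_natRk, ← coe_natRk] at h
    exact_mod_cast h
  have hE : M✶.natRk M.E + M.natRk M.E = M.ground_finite.toFinset.card := by
    have := key M.ground_finite.toFinset (by simp)
    simpa [natRk] using this
  rw [tutteEval_eq_sum, tutteEval_eq_sum]
  refine Finset.sum_nbij' (fun A ↦ M.ground_finite.toFinset \ A)
    (fun A ↦ M.ground_finite.toFinset \ A) ?_ ?_ ?_ ?_ ?_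
  · intro A _; simp
  · intro A _; simp
  · intro A hA
    exact Finset.sdiff_sdiff_eq_self (by simpa using hA)
  · intro A hA
    exact Finset.sdiff_sdiff_eq_self (by simpa using hA)
  · intro A hA
    have hA' : A ⊆ M.ground_finite.toFinset := by simpa using hA
    have hAE : (A : Set α) ⊆ M.E := by simpa using hA
    have h1 := key A hAE
    have h2 := Finset.card_sdiff_add_card_eq_card hA'
    have h3 := natRk_le_card M✶ A
    have h4 := natRk_mono M (sdiff_subset (s := M.E) (t := (A : Set α)))
    have h5 := natRk_mono M✶ hAE
    have h6 := natRk_le_card M (M.ground_finite.toFinset \ A)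
    rw [Finset.coe_sdiff, Finite.coe_toFinset] at h6
    rw [tutteTerm, tutteTerm, mul_comm, dual_ground, Finset.coe_sdiff, Finite.coe_toFinset]
    congr 2 <;> omega

lemma natRk_disjointSum {N : Matroid α} [M.Finite] [N.Finite] (h : Disjoint M.E N.E)
    [(M.disjointSum N h).Finite] {A B : Set α} (hA : A ⊆ M.E) (hB : B ⊆ N.E) :
    (M.disjointSum N h).natRk (A ∪ B) = M.natRk A + N.natRk B := by
  obtain ⟨I, hI⟩ := M.exists_isBasis A
  obtain ⟨J, hJ⟩ := N.exists_isBasis B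
  have aux {X Y : Set α} (hX : X ⊆ M.E) (hY : Y ⊆ N.E) :
      (X ∪ Y) ∩ M.E = X ∧ (X ∪ Y) ∩ N.E = Y := by
    rw [union_inter_distrib_right, union_inter_distrib_right, inter_eq_left.2 hX,
      inter_eq_left.2 hY, (h.symm.mono_left hY).inter_eq, (h.mono_left hX).inter_eq]
    simp
  have hIM := hI.indep.subset_ground
  have hJN := hJ.indep.subset_ground
  have hb : (M.disjointSum N h).IsBasis (I ∪ J) (A ∪ B) := by
    rw [disjointSum_isBasis_iff, (aux hA hB).1, (aux hA hB).2, (aux hIM hJN).1, (aux hIM hJN).2]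
    exact ⟨hI, hJ, union_subset_union hI.subset hJ.subset, union_subset_union hA hB⟩
  have h1 := hb.eRk_eq_encard
  rw [encard_union_eq (h.mono hIM hJN), ← hI.eRk_eq_encard, ← hJ.eRk_eq_encard, ← coe_natRk,
    ← coe_natRk, ← coe_natRk] at h1
  exact_mod_cast h1

theorem tutteEval_disjointSum {N : Matroid α} [M.Finite] [N.Finite] (h : Disjoint M.E N.E)
    [(M.disjointSum N h).Finite] (x y : ℤ) :
    (M.disjointSum N h).tutteEval x y = M.tutteEval x y * N.tutteEval x y := by
  classical
  rw [tutteEval_eq_sum, tutteEval_eq_sum M, tutteEval_eq_sum N, Finset.sum_mul_sum,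
    ← Finset.sum_product']
  symm
  refine Finset.sum_nbij' (fun p ↦ p.1 ∪ p.2)
    (fun A ↦ (A ∩ M.ground_finite.toFinset, A ∩ N.ground_finite.toFinset)) ?_ ?_ ?_ ?_ ?_
  · rintro ⟨A, B⟩ hp
    simp only [Finset.mem_product, Finset.mem_powerset, Finite.subset_toFinset] at hp
    simp only [disjointSum_ground_eq, Finset.mem_powerset, Finite.subset_toFinset,
      Finset.coe_union]
    exact union_subset_union hp.1 hp.2
  · intro A _
    simp
  · rintro ⟨A, B⟩ hp
    simp only [Finset.mem_product, Finset.mem_powerset, Finite.subset_toFinset] at hp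
    ext a
    · have this : a ∈ A → a ∈ M.E := fun ha ↦ hp.1 ha
      have h' : a ∈ B → a ∈ N.E := fun ha ↦ hp.2 ha
      have hd : a ∈ M.E → a ∉ N.E := fun ha ↦ disjoint_left.1 h ha
      simp at *; tauto
    · have this : a ∈ A → a ∈ M.E := fun ha ↦ hp.1 ha
      have h' : a ∈ B → a ∈ N.E := fun ha ↦ hp.2 ha
      have hd : a ∈ M.E → a ∉ N.E := fun ha ↦ disjoint_left.1 h ha
      simp at *; tauto
  · intro A hA
    simp only [disjointSum_ground_eq, Finset.mem_powerset, Finite.subset_toFinset] at hA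
    ext a
    have : a ∈ A → a ∈ M.E ∪ N.E := fun ha ↦ hA ha
    simp at *; tauto
  · rintro ⟨A, B⟩ hp
    simp only [Finset.mem_product, Finset.mem_powerset, Finite.subset_toFinset] at hp
    obtain ⟨hA, hB⟩ := hp
    have hAB : Disjoint A B := by
      rw [← Finset.disjoint_coe]; exact h.mono hA hB
    simp only [tutteTerm, disjointSum_ground_eq, Finset.coe_union]
    rw [natRk_disjointSum h hA hB, natRk_disjointSum h subset_rfl subset_rfl,
      Finset.card_union_of_disjoint hAB]
    have h1 := natRk_mono M hA
    have h2 := natRk_mono N hB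
    have h3 := natRk_le_card M A
    have h4 := natRk_le_card N B
    rw [show M.natRk M.E + N.natRk N.E - (M.natRk A + N.natRk B) =
      (M.natRk M.E - M.natRk A) + (N.natRk N.E - N.natRk B) by omega,
      show A.card + B.card - (M.natRk A + N.natRk B) =
      (A.card - M.natRk A) + (B.card - N.natRk B) by omega, pow_add, pow_add]
    ring

/-- The Merino-Welsh inequality for numbers `a`, `b`, `c` in place of the Tutte evaluations at
`(2, 0)`, `(0, 2)` and `(1, 1)`. -/
def IsMWTriple (a b c : ℤ) : Prop := 0 ≤ a ∧ 0 ≤ b ∧ c ^ 2 ≤ a * b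

lemma IsMWTriple.add {a b c a' b' c' : ℤ} (h : IsMWTriple a b c) (h' : IsMWTriple a' b' c') :
    IsMWTriple (a + a') (b + b') (c + c') := by
  obtain ⟨ha, hb, hc⟩ := h
  obtain ⟨ha', hb', hc'⟩ := h'
  refine ⟨by positivity, by positivity, ?_⟩
  have h1 : (2 * (c * c')) ^ 2 ≤ (a * b' + a' * b) ^ 2 := by
    have := mul_le_mul hc hc' (by positivity) (by positivity)
    nlinarith [sq_nonneg (a * b' - a' * b)]
  have h2 := (le_abs_self _).trans (abs_le_of_sq_le_sq h1 (by positivity))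
  nlinarith

lemma IsMWTriple.mul {a b c a' b' c' : ℤ} (h : IsMWTriple a b c) (h' : IsMWTriple a' b' c') :
    IsMWTriple (a * a') (b * b') (c * c') := by
  obtain ⟨ha, hb, hc⟩ := h
  obtain ⟨ha', hb', hc'⟩ := h'
  refine ⟨by positivity, by positivity, ?_⟩
  have := mul_le_mul hc hc' (by positivity) (by positivity)
  calc _ = c ^ 2 * c' ^ 2 := by ring
    _ ≤ _ := this
    _ = _ := by ring

lemma IsMWTriple.symm {a b c : ℤ} (h : IsMWTriple a b c) : IsMWTriple b a c :=
  ⟨h.2.1, h.1, by rw [mul_comm]; exact h.2.2⟩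

lemma IsMWTriple.two_mul_le {a b c : ℤ} (h : IsMWTriple a b c) : 2 * c ≤ a + b := by
  obtain ⟨ha, hb, hc⟩ := h
  refine (le_abs_self _).trans (abs_le_of_sq_le_sq ?_ (by positivity))
  nlinarith [sq_nonneg (a - b)]

/-- The matroid `M` satisfies the multiplicative Merino-Welsh inequality. -/
def MerinoWelsh (M : Matroid α) [M.Finite] : Prop :=
  IsMWTriple (M.tutteEval 2 0) (M.tutteEval 0 2) (M.tutteEval 1 1)

lemma merinoWelsh_of_dual [M.Finite] (h : M✶.MerinoWelsh) : M.MerinoWelsh := by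
  simp only [MerinoWelsh, tutteEval_dual] at h
  exact h.symm

/-- No minor of `M` has a loop, a coloop, and an element that is neither. -/
def NoMixedMinor (M : Matroid α) : Prop :=
  ∀ N, N ≤m M → ∀ e f g, N.IsLoop e → N.IsColoop f → g ∈ N.E → N.IsLoop g ∨ N.IsColoop g

lemma NoMixedMinor.minor (hM : M.NoMixedMinor) (h : N ≤m M) : N.NoMixedMinor :=
  fun N' h' ↦ hM N' (h'.trans h)

lemma NoMixedMinor.delete (hM : M.NoMixedMinor) (D : Set α) : (M ＼ D).NoMixedMinor :=
  hM.minor ⟨∅, D, by simp⟩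

lemma NoMixedMinor.contract (hM : M.NoMixedMinor) (C : Set α) : (M ／ C).NoMixedMinor :=
  hM.minor ⟨C, ∅, by simp⟩

lemma NoMixedMinor.dual (hM : M.NoMixedMinor) : M✶.NoMixedMinor := by
  rintro _ ⟨C, D, rfl⟩ e f g he hf hg
  have hm : M ＼ C ／ D ≤m M := ⟨D \ C, C, delete_contract_comm' M C D⟩
  have hN : (M ＼ C ／ D)✶ = M✶ ／ C ＼ D := dual_delete_contract M C D
  rw [← hN] at he hf hg ⊢
  exact (hM _ hm f e g (by rwa [dual_isColoop_iff_isLoop] at hf) he hg).symm.imp id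
    (fun h ↦ h.dual_isColoop)

lemma isCyclicFlat_sUnion_of_isFlat {F : Set α} (hF : M.IsFlat F) :
    M.IsCyclicFlat (⋃₀ {C | M.IsCircuit C ∧ C ⊆ F}) := by
  have hsub : ⋃₀ {C | M.IsCircuit C ∧ C ⊆ F} ⊆ F := sUnion_subset fun C hC ↦ hC.2
  refine ⟨?_, _, fun C hC ↦ hC.1, rfl⟩
  rw [isFlat_iff_closure_eq]
  refine subset_antisymm (fun a ha ↦ ?_) (M.subset_closure _ (hsub.trans hF.subset_ground))
  by_contra hn
  obtain ⟨K, hK, hKC, haK⟩ := exists_isCircuit_of_mem_closure ha hn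
  have haF : a ∈ F := by
    rw [← hF.closure]
    exact M.closure_subset_closure hsub ha
  exact hn ⟨K, ⟨hKC, hK.trans (insert_subset haF hsub)⟩, haK⟩

lemma IsConnectedSplit.noMixedMinor (h : M.IsConnectedSplit) : M.NoMixedMinor := by
  rintro _ ⟨C, D, rfl⟩ e f g he hf hg
  by_contra! hg'
  obtain ⟨hgl, hgc⟩ := hg'
  have hgE : g ∈ M.E ∧ g ∉ C ∧ g ∉ D := by simpa [and_assoc] using hg
  rw [delete_isLoop_iff, contract_isLoop_iff_mem_closure] at he hgl
  have hgl : g ∉ M.closure C := fun h ↦ hgl ⟨⟨h, hgE.2.1⟩, hgE.2.2⟩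
  rw [delete_isColoop_iff, contract_closure_eq] at hf hgc
  set X : α → Set α := fun a ↦ ((M ／ C).E \ D) \ {a} ∪ C with hX
  have hfE : f ∈ M.E ∧ f ∉ C := by simpa using hf.2.1
  have hfX : f ∉ M.closure (X f) := fun h ↦ hf.1 ⟨h, hfE.2⟩
  have hgX : g ∈ M.closure (X g) := by
    by_contra h
    exact hgc ⟨fun h' ↦ h h'.1, ⟨hgE.1, hgE.2.1⟩, hgE.2.2⟩
  obtain ⟨K, hKX, hK, hgK⟩ := exists_isCircuit_of_mem_closure hgX (by simp [hX, hgE])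
  have hKf : K \ {f} ⊆ X f := by
    intro a ha
    have := hKX ha.1
    simp only [hX, mem_insert_iff, mem_union, mem_sdiff, contract_ground, mem_singleton_iff]
      at this ha ⊢
    rcases this with rfl | h | h
    · tauto
    · tauto
    · tauto
  have hfK : f ∉ K := fun h ↦
    hfX (M.closure_subset_closure hKf (hK.mem_closure_sdiff_singleton_of_mem h))
  rw [sdiff_singleton_eq_self hfK] at hKf
  have hKf' : K ⊆ M.closure (X f) :=
    (subset_inter hKf hK.subset_ground).trans (M.inter_ground_subset_closure _)
  have hCX : M.closure C ⊆ M.closure (X f) := M.closure_subset_closure subset_union_right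
  obtain ⟨K', hKX', hK', heK'⟩ := exists_isCircuit_of_mem_closure he.1.1 he.1.2
  have hKC' : K' ⊆ M.closure C := by
    intro a ha
    rcases hKX' ha with rfl | h
    · exact he.1.1
    · exact M.inter_ground_subset_closure C ⟨h, hK'.subset_ground ha⟩
  have hss : ⋃₀ {C' | M.IsCircuit C' ∧ C' ⊆ M.closure C} ⊂
      ⋃₀ {C' | M.IsCircuit C' ∧ C' ⊆ M.closure (X f)} := by
    refine (ssubset_iff_of_subset (sUnion_subset_sUnion fun K₁ hK₁ ↦
      And.intro hK₁.1 (hK₁.2.trans hCX))).2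
      ⟨g, ⟨K, ⟨hK, hKf'⟩, hgK⟩, ?_⟩
    rintro ⟨K₁, hK₁, hgK₁⟩
    exact hgl (hK₁.2 hgK₁)
  rcases h.2 _ _ (isCyclicFlat_sUnion_of_isFlat (M.isFlat_closure C))
    (isCyclicFlat_sUnion_of_isFlat (M.isFlat_closure (X f))) hss with h0 | h1
  · have : e ∈ ⋃₀ {C' | M.IsCircuit C' ∧ C' ⊆ M.closure C} := ⟨K', ⟨hK', hKC'⟩, heK'⟩
    rw [h0] at this
    exact this
  · have : f ∈ M.E := hfE.1
    rw [← h1] at this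
    obtain ⟨K₁, hK₁, hfK₁⟩ := this
    exact hfX (hK₁.2 hfK₁)

lemma IsUniform.noMixedMinor (h : M.IsUniform) : M.NoMixedMinor := by
  obtain ⟨k, hk⟩ := h
  rintro _ ⟨C, D, rfl⟩ e f g he hf hg
  left
  have hgE : g ∈ M.E ∧ g ∉ C ∧ g ∉ D := by simpa [and_assoc] using hg
  rw [delete_isLoop_iff, contract_isLoop_iff_mem_closure] at he ⊢
  refine ⟨⟨?_, hgE.2.1⟩, hgE.2.2⟩
  by_contra hgC
  obtain ⟨I, hI⟩ := M.exists_isBasis' C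
  have heI : e ∉ I := fun h ↦ he.1.2 (hI.subset h)
  have hgI : g ∉ I := fun h ↦ hgE.2.1 (hI.subset h)
  rw [← hI.closure_eq_closure] at he hgC
  have h1 : M.Indep (insert g I) := (hI.indep.insert_indep_iff_of_notMem hgI).2 ⟨hgE.1, hgC⟩
  have h2 : M.Indep (insert e I) := by
    rw [hk] at h1 ⊢
    rw [encard_insert_of_notMem heI]
    rw [encard_insert_of_notMem hgI] at h1
    exact ⟨insert_subset (mem_ground_of_mem_closure he.1.1) hI.indep.subset_ground, h1.2⟩
  exact ((hI.indep.insert_indep_iff_of_notMem heI).1 h2).2 he.1.1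

lemma tutteEval_eq_pow_mul_delete [DecidableEq α] (L : Finset α) :
    ∀ (M : Matroid α) [M.Finite], (∀ f ∈ L, M.IsLoop f) → ∀ x y : ℤ,
      M.tutteEval x y = y ^ L.card * (M ＼ (L : Set α)).tutteEval x y := by
  induction L using Finset.induction_on with
  | empty => intro M _ _ x y; simp
  | insert l L hl ih =>
    intro M _ h x y
    have h1 := (h l (by simp)).tutteEval_eq x y
    rw [h1, ih (M ＼ {l}) (fun f hf ↦ delete_isLoop_iff.2 ⟨h f (by simp [hf]),
      fun h' ↦ hl (by rwa [← mem_singleton_iff.1 h'])⟩),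
      tutteEval_congr (show M ＼ {l} ＼ (L : Set α) = M ＼ ((insert l L : Finset α) : Set α) by
        simp [delete_delete]), Finset.card_insert_of_notMem hl]
    ring

/-- Removing elements parallel to a fixed element `e`. -/
lemma tutteEval_eq_delete_parallel [DecidableEq α] (L : Finset α) :
    ∀ (M : Matroid α) [M.Finite], M.IsNonloop e → (∀ f ∈ L, M.IsNonloop f) →
      (∀ f ∈ L, (M ／ {e}).IsLoop f) → ∀ x y : ℤ,
      M.tutteEval x y = (M ＼ (L : Set α)).tutteEval x y +
        (∑ i ∈ Finset.range L.card, y ^ (i + 1)) * (M ／ {e} ＼ (L : Set α)).tutteEval x y := by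
  induction L using Finset.induction_on with
  | empty =>
    intro M _ _ _ _ x y
    simp
  | insert l L hl ih =>
    intro M _ he hnl h x y
    have hle := contract_isLoop_iff_mem_closure.1 (h l (by simp))
    have hel : e ≠ l := fun h ↦ hle.2 h.symm
    have hlnl := hnl l (by simp)
    have hecl : e ∈ M.closure {l} := hlnl.mem_closure_singleton hle.1
    have hcol : ¬ M.IsColoop l := fun hc ↦ hle.2 (hc.mem_of_mem_closure hle.1)
    have hne : ∀ f ∈ L, f ≠ l := fun f hf h ↦ hl (h ▸ hf)
    have hloops : ∀ f ∈ L, f ∈ M.closure {e} ∧ f ≠ e := fun f hf ↦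
      contract_isLoop_iff_mem_closure.1 (h f (by simp [hf]))
    have heL : e ∉ L := fun h ↦ (hloops e h).2 rfl
    have h1 := ih (M ＼ {l}) (delete_isNonloop_iff.2 ⟨he, hel⟩)
      (fun f hf ↦ delete_isNonloop_iff.2 ⟨hnl f (by simp [hf]), hne f hf⟩)
      (fun f hf ↦ by
        rw [contract_isLoop_iff_mem_closure, delete_closure_eq,
          sdiff_singleton_eq_self (fun h ↦ hel (mem_singleton_iff.1 h).symm)]
        exact ⟨⟨(hloops f hf).1, hne f hf⟩, (hloops f hf).2⟩) x y
    have h2 := tutteEval_eq_pow_mul_delete (insert e L) (M ／ {l}) (fun f hf ↦ by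
      rw [contract_isLoop_iff_mem_closure]
      rcases Finset.mem_insert.1 hf with rfl | hf
      · exact ⟨hecl, hel⟩
      · refine ⟨?_, hne f hf⟩
        rw [← he.closure_eq_of_mem_closure hecl]
        exact (hloops f hf).1) x y
    have e1 : M ＼ {l} ＼ (L : Set α) = M ＼ ((insert l L : Finset α) : Set α) := by
      simp [delete_delete]
    have e2 : M ＼ {l} ／ {e} ＼ (L : Set α) = M ／ {e} ＼ ((insert l L : Finset α) : Set α) := by
      rw [← contract_delete_comm _ (by simpa using hel), delete_delete]
      simp
    have e3 : M ／ {l} ＼ ((insert e L : Finset α) : Set α) =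
        M ／ {e} ＼ ((insert l L : Finset α) : Set α) := by
      have h3 : M ／ {l} ＼ {e} = M ／ {l} ／ {e} := by
        refine (contract_eq_delete_of_subset_loops ?_).symm
        rw [contract_loops_eq]
        exact singleton_subset_iff.2 ⟨hecl, hel⟩
      have h4 : M ／ {e} ＼ {l} = M ／ {e} ／ {l} := by
        refine (contract_eq_delete_of_subset_loops ?_).symm
        rw [contract_loops_eq]
        exact singleton_subset_iff.2 hle
      rw [Finset.coe_insert, Finset.coe_insert, insert_eq, insert_eq, ← delete_delete,
        ← delete_delete, h3, h4, contract_comm]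
    rw [tutteEval_congr e1, tutteEval_congr e2] at h1
    rw [tutteEval_congr e3, Finset.card_insert_of_notMem heL] at h2
    rw [tutteEval_eq_delete_add_contract hlnl hcol, h1, h2, Finset.card_insert_of_notMem hl,
      Finset.sum_range_succ]
    ring

/-- The Tutte polynomial of a parallel class. -/
lemma tutteEval_of_isParallelClass [M.Finite] [DecidableEq α] {L : Finset α}
    (hE : M.E = insert e (L : Set α)) (heL : e ∉ L) (hnl : ∀ f ∈ M.E, ¬ M.IsLoop f)
    (hL : ∀ f ∈ L, f ∈ M.closure {e}) (x y : ℤ) :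
    M.tutteEval x y = x + ∑ i ∈ Finset.range L.card, y ^ (i + 1) := by
  have heE : e ∈ M.E := by simp [hE]
  have hnl' : ∀ f ∈ M.E, M.IsNonloop f := fun f hf ↦ isNonloop_of_not_isLoop hf (hnl f hf)
  have h1 := tutteEval_eq_delete_parallel L M (hnl' e heE) (fun f hf ↦ hnl' f (by simp [hE, hf]))
    (fun f hf ↦ contract_isLoop_iff_mem_closure.2 ⟨hL f hf, fun h ↦ heL (by
      rwa [← mem_singleton_iff.1 h])⟩) x y
  have hcol : (M ＼ (L : Set α)).IsColoop e := by
    rw [delete_isColoop_iff]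
    refine ⟨?_, heE, by simpa using heL⟩
    have : (M.E \ (L : Set α)) \ {e} = ∅ := by
      rw [hE]; ext a; simp; tauto
    rw [this]
    exact hnl e heE
  rw [h1, hcol.tutteEval_eq, tutteEval_of_ground_eq_empty, tutteEval_of_ground_eq_empty]
  · ring
  · simp only [delete_ground, contract_ground, hE]; ext a; simp
  · simp only [delete_ground, hE]; ext a; simp; tauto

lemma sum_range_two_pow_succ (m : ℕ) :
    ∑ i ∈ Finset.range m, (2 : ℤ) ^ (i + 1) = 2 ^ (m + 1) - 2 := by
  induction m with
  | zero => simp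
  | succ m ih => rw [Finset.sum_range_succ, ih]; ring

lemma sum_range_zero_pow_succ (m : ℕ) : ∑ i ∈ Finset.range m, (0 : ℤ) ^ (i + 1) = 0 := by simp

lemma sum_range_one_pow_succ (m : ℕ) : ∑ i ∈ Finset.range m, (1 : ℤ) ^ (i + 1) = m := by simp

lemma isMWTriple_add_sum {m : ℕ} (hm : 1 ≤ m) :
    IsMWTriple (2 + ∑ i ∈ Finset.range m, (0 : ℤ) ^ (i + 1))
      (0 + ∑ i ∈ Finset.range m, (2 : ℤ) ^ (i + 1))
      (1 + ∑ i ∈ Finset.range m, (1 : ℤ) ^ (i + 1)) := by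
  rw [sum_range_two_pow_succ, sum_range_zero_pow_succ, sum_range_one_pow_succ]
  have h1 : (2 : ℤ) ^ 1 ≤ 2 ^ (m + 1) := pow_le_pow_right₀ (by norm_num) (by omega)
  refine ⟨by norm_num, by linarith, ?_⟩
  clear h1
  induction m, hm using Nat.le_induction with
  | base => norm_num
  | succ m hm ih =>
    have : (1 : ℤ) ≤ m := by exact_mod_cast hm
    rw [pow_succ (2 : ℤ) (m + 1)]
    push_cast at ih ⊢
    nlinarith

lemma sq_add_two_le {m : ℕ} (hm : 1 ≤ m) : ((m : ℤ) + 1) ^ 2 + 1 ≤ 2 ^ (m + 2) - 2 := by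
  induction m, hm using Nat.le_induction with
  | base => norm_num
  | succ m hm ih =>
    have : (1 : ℤ) ≤ m := by exact_mod_cast hm
    rw [show m + 1 + 2 = m + 2 + 1 by ring, pow_succ (2 : ℤ) (m + 2)]
    push_cast at ih ⊢
    nlinarith

lemma isMWTriple_one_add_sum_mul {m n : ℕ} (hm : 1 ≤ m) (hn : 3 ≤ n) :
    IsMWTriple
      ((1 + ∑ i ∈ Finset.range m, (0 : ℤ) ^ (i + 1)) *
        (2 + ∑ i ∈ Finset.range n, (0 : ℤ) ^ (i + 1)))
      ((1 + ∑ i ∈ Finset.range m, (2 : ℤ) ^ (i + 1)) *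
        (0 + ∑ i ∈ Finset.range n, (2 : ℤ) ^ (i + 1)))
      ((1 + ∑ i ∈ Finset.range m, (1 : ℤ) ^ (i + 1)) *
        (1 + ∑ i ∈ Finset.range n, (1 : ℤ) ^ (i + 1))) := by
  simp only [sum_range_two_pow_succ, sum_range_zero_pow_succ, sum_range_one_pow_succ]
  have h1 : 4 * (1 + (m : ℤ)) ^ 2 ≤ 7 * (1 + (2 ^ (m + 1) - 2)) := by
    clear hn
    induction m, hm using Nat.le_induction with
    | base => norm_num
    | succ m hm ih =>
      have : (1 : ℤ) ≤ m := by exact_mod_cast hm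
      rw [pow_succ (2 : ℤ) (m + 1)]
      push_cast at ih ⊢
      nlinarith
  have h2 : 7 * (1 + (n : ℤ)) ^ 2 ≤ 8 * (0 + (2 ^ (n + 1) - 2)) := by
    clear h1 hm
    induction n, hn using Nat.le_induction with
    | base => norm_num
    | succ n hn ih =>
      have : (3 : ℤ) ≤ n := by exact_mod_cast hn
      rw [pow_succ (2 : ℤ) (n + 1)]
      push_cast at ih ⊢
      nlinarith
  have h3 : 0 ≤ 7 * (1 + ((2 : ℤ) ^ (m + 1) - 2)) := le_trans (by positivity) h1
  have h4 : 0 ≤ 8 * (0 + ((2 : ℤ) ^ (n + 1) - 2)) := le_trans (by positivity) h2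
  refine ⟨by norm_num, mul_nonneg (by linarith) (by linarith), ?_⟩
  have := mul_le_mul h1 h2 (by positivity) h3
  nlinarith

lemma isMWTriple_thick_cycle {m n : ℕ} (hm : 1 ≤ m) (hn : 1 ≤ n) :
    IsMWTriple
      (0 + ∑ i ∈ Finset.range (n + 1), (2 : ℤ) ^ (i + 1) + (∑ i ∈ Finset.range m, 0 ^ (i + 1)) *
        (0 + ∑ i ∈ Finset.range n, (2 : ℤ) ^ (i + 1)))
      (2 + ∑ i ∈ Finset.range (n + 1), (0 : ℤ) ^ (i + 1) + (∑ i ∈ Finset.range m, 2 ^ (i + 1)) *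
        (2 + ∑ i ∈ Finset.range n, (0 : ℤ) ^ (i + 1)))
      (1 + ∑ i ∈ Finset.range (n + 1), (1 : ℤ) ^ (i + 1) + (∑ i ∈ Finset.range m, 1 ^ (i + 1)) *
        (1 + ∑ i ∈ Finset.range n, (1 : ℤ) ^ (i + 1))) := by
  simp only [sum_range_two_pow_succ, sum_range_zero_pow_succ, sum_range_one_pow_succ]
  have h1 := sq_add_two_le hm
  have h2 := sq_add_two_le hn
  have e1 : (0 + (2 ^ (n + 1 + 1) - 2) + 0 * (0 + (2 ^ (n + 1) - 2)) : ℤ) = 2 ^ (n + 2) - 2 := by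
    ring
  have e2 : (2 + 0 + (2 ^ (m + 1) - 2) * (2 + 0) : ℤ) = 2 ^ (m + 2) - 2 := by ring
  rw [e1, e2]
  have h3 : 0 ≤ (2 : ℤ) ^ (m + 2) - 2 := le_trans (by positivity) h1
  have h4 : 0 ≤ (2 : ℤ) ^ (n + 2) - 2 := le_trans (by positivity) h2
  refine ⟨h4, h3, ?_⟩
  have := mul_le_mul h2 h1 (by positivity) h4
  push_cast
  nlinarith [sq_nonneg ((m : ℤ) - n)]

lemma contract_isLoop_singleton_iff : (M ／ {e}).IsLoop f ↔ f ∈ M.closure {e} ∧ f ≠ e :=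
  contract_isLoop_iff_mem_closure

lemma mem_closure_singleton_trans {a b c : α} (hab : a ∈ M.closure {b}) (hbc : b ∈ M.closure {c}) :
    a ∈ M.closure {c} :=
  M.closure_subset_closure_of_subset_closure (singleton_subset_iff.2 hbc) hab

/-- The Tutte polynomial of a series class. -/
lemma tutteEval_of_isSeriesClass [M.Finite] [DecidableEq α] {K : Finset α}
    (hE : M.E = insert s (K : Set α)) (hsK : s ∉ K) (hcol : ∀ f, ¬ M.IsColoop f)
    (hK : ∀ f ∈ K, (M ＼ {s}).IsColoop f) (x y : ℤ) :
    M.tutteEval x y = y + ∑ i ∈ Finset.range K.card, x ^ (i + 1) := by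
  rw [← tutteEval_dual]
  refine tutteEval_of_isParallelClass (M := M✶) hE hsK (fun f _ ↦ hcol f) (fun f hf ↦ ?_) _ _
  have := hK f hf
  rw [← dual_isLoop_iff_isColoop, dual_delete, contract_isLoop_singleton_iff] at this
  exact this.1

lemma IsColoop.delete_eq_contract_delete {L : Set α} (h : (M ＼ L).IsColoop e) :
    M ＼ L ＼ {e} = M ／ {e} ＼ L := by
  have he : e ∉ L := h.mem_ground.2
  rw [contract_delete_comm _ (by simpa using he)]
  exact (contract_eq_delete_of_subset_coloops (singleton_subset_iff.2 h)).symm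

lemma isColoop_of_isColoop_delete_parallel {L : Set α} (hL : L ⊆ M.closure {e}) (heE : e ∈ M.E)
    (heL : e ∉ L) (h : (M ＼ L).IsColoop f) (hfe : f ≠ e) : M.IsColoop f := by
  rw [delete_isColoop_iff] at h
  rw [isColoop_iff_notMem_closure_compl h.2.1]
  have h1 : e ∈ (M.E \ L) \ {f} := ⟨⟨heE, heL⟩, hfe.symm⟩
  refine fun h2 ↦ h.1 (M.closure_subset_closure_of_subset_closure (fun a ha ↦ ?_) h2)
  by_cases haL : a ∈ L
  · exact M.closure_subset_closure (singleton_subset_iff.2 h1) (hL haL)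
  · exact M.mem_closure_of_mem' ⟨⟨ha.1, haL⟩, ha.2⟩ ha.1

/-- A matroid which decomposes into a parallel class and a series class satisfies the
Merino-Welsh inequality. -/
lemma merinoWelsh_of_parallel_of_series [M.Finite] (hM : M.NoMixedMinor)
    (hloop : ∀ e, ¬ M.IsLoop e) (hcoloop : ∀ e, ¬ M.IsColoop e)
    (hf : f ∈ M.closure {e}) (hfe : f ≠ e) (ht : (M ＼ {s}).IsColoop t) (hsE : s ∈ M.E)
    (hes : e ≠ s) (het : e ≠ t) (hfs : f ≠ s) : M.MerinoWelsh := by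
  classical
  have hnl : ∀ a ∈ M.E, M.IsNonloop a := fun a ha ↦ isNonloop_of_not_isLoop ha (hloop a)
  have hfE := mem_ground_of_mem_closure hf
  have heE : e ∈ M.E := mem_ground_of_mem_closure ((hnl f hfE).mem_closure_singleton hf)
  have ht' := (delete_isColoop_iff _ _).1 ht
  have hscl : s ∉ M.closure {e} := by
    intro h
    refine hcoloop t (isColoop_of_isColoop_delete_parallel (singleton_subset_iff.2 h) heE
      (by simpa using hes) ht het.symm)
  obtain ⟨L, hL⟩ := (M.ground_finite.subset
    (sdiff_subset.trans (M.closure_subset_ground {e}) : M.closure {e} \ {e} ⊆ M.E)).exists_finset_coe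
  have hmemL : ∀ a, a ∈ L ↔ a ∈ M.closure {e} ∧ a ≠ e := fun a ↦ by
    rw [← Finset.mem_coe, hL]; rfl
  obtain ⟨K, hK⟩ := (M.ground_finite.subset
    (sdiff_subset : M.E \ insert s (M.closure {e}) ⊆ M.E)).exists_finset_coe
  have hmemK : ∀ a, a ∈ K ↔ a ∈ M.E ∧ a ≠ s ∧ a ∉ M.closure {e} := fun a ↦ by
    rw [← Finset.mem_coe, hK]; simp
  have hfL : f ∈ L := (hmemL f).2 ⟨hf, hfe⟩
  have hecl : e ∈ M.closure {e} := M.mem_closure_of_mem' rfl heE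
  have heL : e ∉ L := fun h ↦ ((hmemL e).1 h).2 rfl
  have htK : t ∈ K := by
    refine (hmemK t).2 ⟨ht'.2.1, ht'.2.2, fun h ↦ ht'.1 ?_⟩
    have : e ∈ (M.E \ {s}) \ {t} := ⟨⟨heE, hes⟩, het⟩
    exact M.closure_subset_closure (singleton_subset_iff.2 this) h
  have hKcol : ∀ k ∈ K, (M ＼ {s}).IsColoop k := by
    intro k hk
    rw [hmemK] at hk
    have hke : k ≠ e := fun h ↦ hk.2.2 (h ▸ hecl)
    have hcomm : M ／ {e} ＼ {s} = M ＼ {s} ／ {e} := contract_delete_comm _ (by simpa using hes)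
    rcases hM (M ／ {e} ＼ {s}) (contract_delete_isMinor _ _ _) f t k
      (delete_isLoop_iff.2 ⟨contract_isLoop_singleton_iff.2 ⟨hf, hfe⟩, hfs⟩)
      (by rw [hcomm]; exact contract_isColoop_iff.2 ⟨ht, het.symm⟩)
      ⟨⟨hk.1, hke⟩, hk.2.1⟩ with h | h
    · exact absurd (contract_isLoop_singleton_iff.1 (delete_isLoop_iff.1 h).1).1 hk.2.2
    · rw [hcomm] at h
      exact (contract_isColoop_iff.1 h).1
  have hsK : s ∉ K := fun h ↦ ((hmemK s).1 h).2.1 rfl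
  have hKcol' : ∀ k ∈ K, k ∉ M.closure ((M.E \ {s}) \ {k}) := fun k hk ↦
    ((delete_isColoop_iff _ _).1 (hKcol k hk)).1
  have hQ : ∀ x y, (M ／ {e} ＼ (L : Set α)).tutteEval x y =
      y + ∑ i ∈ Finset.range K.card, x ^ (i + 1) := by
    refine tutteEval_of_isSeriesClass (s := s) ?_ hsK ?_ ?_
    · ext a
      simp only [delete_ground, contract_ground, mem_sdiff, Finset.mem_coe, mem_insert_iff,
        mem_singleton_iff, hmemL, hmemK]
      by_cases h1 : a = s
      · simp [h1, hsE, hes.symm, hscl]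
      · by_cases h2 : a = e
        · simp [h2, hecl, hes]
        · simp only [h1, h2, false_or]; tauto
    · intro c hc
      rw [← contract_eq_delete_of_subset_loops, contract_contract, contract_isColoop_iff] at hc
      · exact hcoloop c hc.1
      · rw [contract_loops_eq, hL]
    · intro k hk
      have hk' := (hmemK k).1 hk
      have hke : k ≠ e := fun h ↦ hk'.2.2 (h ▸ hecl)
      have h1 : M ／ {e} ＼ (L : Set α) ＼ {s} = M ＼ ((L : Set α) ∪ {s}) ／ {e} := by
        rw [delete_delete, contract_delete_comm]
        simp [heL, hes]
      rw [h1, contract_isColoop_iff, delete_isColoop_iff]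
      refine ⟨⟨fun h ↦ hKcol' k hk (M.closure_subset_closure ?_ h), hk'.1, ?_⟩, hke⟩
      · intro a ha
        exact ⟨⟨ha.1.1, fun h ↦ ha.1.2 (Or.inr h)⟩, ha.2⟩
      · rintro (h | h)
        · exact hk'.2.2 ((hmemL k).1 h).1
        · exact hk'.2.1 h
  have hT := tutteEval_eq_delete_parallel L M (hnl e heE)
    (fun a ha ↦ hnl a (mem_ground_of_mem_closure ((hmemL a).1 ha).1))
    (fun a ha ↦ contract_isLoop_singleton_iff.2 ((hmemL a).1 ha))
  have hLcard : 1 ≤ L.card := Finset.card_pos.2 ⟨f, hfL⟩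
  have hKcard : 1 ≤ K.card := Finset.card_pos.2 ⟨t, htK⟩
  by_cases hecol : (M ＼ (L : Set α)).IsColoop e
  · have hT' : ∀ x y, M.tutteEval x y = (x + ∑ i ∈ Finset.range L.card, y ^ (i + 1)) *
        (y + ∑ i ∈ Finset.range K.card, x ^ (i + 1)) := by
      intro x y
      rw [hT, hecol.tutteEval_eq, tutteEval_congr hecol.delete_eq_contract_delete, hQ]
      ring
    rw [MerinoWelsh, hT', hT', hT']
    exact (isMWTriple_add_sum hLcard).mul (isMWTriple_add_sum hKcard).symm
  · have heK : e ∉ K := fun h ↦ ((hmemK e).1 h).2.2 hecl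
    have hML : ∀ x y, (M ＼ (L : Set α)).tutteEval x y =
        y + ∑ i ∈ Finset.range (K.card + 1), x ^ (i + 1) := by
      rw [← Finset.card_insert_of_notMem heK]
      refine tutteEval_of_isSeriesClass (s := s) ?_ ?_ ?_ ?_
      · ext a
        simp only [delete_ground, mem_sdiff, Finset.mem_coe, mem_insert_iff,
          Finset.mem_insert, hmemL, hmemK]
        by_cases h1 : a = s
        · simp [h1, hsE, hscl]
        · by_cases h2 : a = e
          · simp [h2, heE]
          · simp only [h1, h2, false_or]; tauto
      · simp [hes.symm, hsK]
      · intro c hc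
        by_cases hce : c = e
        · exact hecol (hce ▸ hc)
        · exact hcoloop c (isColoop_of_isColoop_delete_parallel
            (fun a ha ↦ ((hmemL a).1 ha).1) heE heL hc hce)
      · intro k hk
        rw [delete_delete, delete_isColoop_iff]
        rcases Finset.mem_insert.1 hk with rfl | hk
        · refine ⟨fun h ↦ ?_, heE, by simp [heL, hes]⟩
          obtain ⟨C, hCs, hC, heC⟩ := exists_isCircuit_of_mem_closure h (by simp)
          have hCE : C ⊆ M.E \ {s} := by
            intro a ha
            rcases hCs ha with rfl | h
            · exact ⟨heE, hes⟩
            · exact ⟨h.1.1, fun h' ↦ h.1.2 (Or.inr h')⟩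
          have hCe : C ⊆ {k} := by
            intro a ha
            by_contra hae
            have haK : a ∈ K := by
              rcases hCs ha with rfl | h
              · exact absurd rfl hae
              · refine (hmemK a).2 ⟨h.1.1, fun h' ↦ h.1.2 (Or.inr h'), fun h' ↦ ?_⟩
                exact h.1.2 (Or.inl ((hmemL a).2 ⟨h', hae⟩))
            exact hKcol' a haK (M.closure_subset_closure (sdiff_subset_sdiff_left hCE)
              (hC.mem_closure_sdiff_singleton_of_mem ha))
          exact hC.not_indep ((hnl k heE).indep.subset hCe)
        · have hk' := (hmemK k).1 hk
          refine ⟨fun h ↦ hKcol' k hk (M.closure_subset_closure ?_ h), hk'.1, ?_⟩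
          · intro a ha
            exact ⟨⟨ha.1.1, fun h ↦ ha.1.2 (Or.inr h)⟩, ha.2⟩
          · rintro (h | h)
            · exact hk'.2.2 ((hmemL k).1 h).1
            · exact hk'.2.1 h
    simp only [MerinoWelsh, hT, hQ, hML]
    exact isMWTriple_thick_cycle hLcard hKcard

/-- If every element has a parallel partner, the matroid has rank at most two. -/
lemma mem_closure_pair_of_forall_parallel (hM : M.NoMixedMinor) (hloop : ∀ e, ¬ M.IsLoop e)
    (hpar : ∀ e ∈ M.E, ∃ f ∈ M.closure {e}, f ≠ e) (he : e ∈ M.E) (hg : g ∈ M.E)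
    (hge : g ∉ M.closure {e}) {a : α} (ha : a ∈ M.E) : a ∈ M.closure {g, e} := by
  have hnl : ∀ a ∈ M.E, M.IsNonloop a := fun a ha ↦ isNonloop_of_not_isLoop ha (hloop a)
  by_contra hage
  obtain ⟨f, hf, hfe⟩ := hpar e he
  obtain ⟨h, hh, hhg⟩ := hpar g hg
  have hsub_g : M.closure {g} ⊆ M.closure {g, e} := M.closure_subset_closure (by simp)
  have hsub_e : M.closure {e} ⊆ M.closure {g, e} := M.closure_subset_closure (by simp)
  have hge' : g ≠ e := by rintro rfl; exact hge (M.mem_closure_of_mem' rfl hg)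
  have hfE := mem_ground_of_mem_closure hf
  have hhE := mem_ground_of_mem_closure hh
  have hgh : g ∈ M.closure {h} := (hnl h hhE).mem_closure_singleton hh
  have hhe : h ≠ e := by rintro rfl; exact hge hgh
  have hae : a ≠ e := by rintro rfl; exact hage (M.mem_closure_of_mem' (by simp) he)
  have hag : a ≠ g := by rintro rfl; exact hage (M.mem_closure_of_mem' (by simp) ha)
  have hah : a ≠ h := by rintro rfl; exact hage (hsub_g hh)
  have haf : a ≠ f := by rintro rfl; exact hage (hsub_e hf)
  set R : Set α := {f, g, h, a} with hR
  have hRE : R ⊆ (M ／ {e}).E := by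
    rintro b (rfl | rfl | rfl | rfl)
    exacts [⟨hfE, hfe⟩, ⟨hg, hge'⟩, ⟨hhE, hhe⟩, ⟨ha, hae⟩]
  have hdiff : ∀ b, ((M ／ {e}).E \ ((M ／ {e}).E \ R)) \ {b} ∪ {e} = R \ {b} ∪ {e} := fun b ↦ by
    rw [sdiff_sdiff_cancel_left hRE]
  have hacol : (M ／ {e} ＼ ((M ／ {e}).E \ R)).IsColoop a := by
    rw [delete_isColoop_iff, contract_closure_eq, hdiff]
    refine ⟨fun h1 ↦ hage ?_, ⟨ha, hae⟩, fun h ↦ h.2 (by simp [hR])⟩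
    refine M.closure_subset_closure_of_subset_closure ?_ h1.1
    rintro b (⟨rfl | rfl | rfl | rfl, hb⟩ | rfl)
    · exact hsub_e hf
    · exact M.mem_closure_of_mem' (by simp) hg
    · exact hsub_g hh
    · exact absurd rfl hb
    · exact M.mem_closure_of_mem' (by simp) he
  rcases hM _ (contract_delete_isMinor _ _ _) f a g
    (delete_isLoop_iff.2 ⟨contract_isLoop_singleton_iff.2 ⟨hf, hfe⟩, fun h ↦ h.2 (by simp [hR])⟩)
    hacol ⟨hRE (by simp [hR]), fun h ↦ h.2 (by simp [hR])⟩ with h1 | h1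
  · exact hge (contract_isLoop_singleton_iff.1 (delete_isLoop_iff.1 h1).1).1
  · rw [delete_isColoop_iff, contract_closure_eq, hdiff] at h1
    refine h1.1 ⟨M.closure_subset_closure (singleton_subset_iff.2 ?_) hgh, hge'⟩
    exact Or.inl ⟨by simp [hR], hhg⟩

lemma merinoWelsh_of_forall_parallel [M.Finite] (hM : M.NoMixedMinor)
    (hloop : ∀ e, ¬ M.IsLoop e) (hpar : ∀ e ∈ M.E, ∃ f ∈ M.closure {e}, f ≠ e)
    (hne : M.E.Nonempty)
    (ih : ∀ (D : Set α), (D ∩ M.E).Nonempty → (∀ e, ¬ (M ＼ D).IsColoop e) →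
      (M ＼ D).MerinoWelsh) : M.MerinoWelsh := by
  classical
  have hnl : ∀ a ∈ M.E, M.IsNonloop a := fun a ha ↦ isNonloop_of_not_isLoop ha (hloop a)
  have hsymm : ∀ {a b}, a ∈ M.closure {b} → b ∈ M.closure {a} := fun {a b} h ↦
    (hnl a (mem_ground_of_mem_closure h)).mem_closure_singleton h
  obtain ⟨e, he⟩ := hne
  obtain ⟨f, hf, hfe⟩ := hpar e he
  obtain ⟨L, hL⟩ := (M.ground_finite.subset
    (sdiff_subset.trans (M.closure_subset_ground {e}) : M.closure {e} \ {e} ⊆ M.E)).exists_finset_coe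
  have hmemL : ∀ a, a ∈ L ↔ a ∈ M.closure {e} ∧ a ≠ e := fun a ↦ by
    rw [← Finset.mem_coe, hL]; rfl
  have hecl : e ∈ M.closure {e} := M.mem_closure_of_mem' rfl he
  have heL : e ∉ L := fun h ↦ ((hmemL e).1 h).2 rfl
  have hLcard : 1 ≤ L.card := Finset.card_pos.2 ⟨f, (hmemL f).2 ⟨hf, hfe⟩⟩
  by_cases hE : M.E ⊆ M.closure {e}
  · have hT := tutteEval_of_isParallelClass (M := M) (e := e) (L := L) (by
      ext a
      simp only [mem_insert_iff, Finset.mem_coe, hmemL]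
      by_cases h : a = e
      · simp [h, he]
      · simp only [h, false_or, ne_eq, not_false_eq_true, and_true]
        exact ⟨fun h ↦ hE h, mem_ground_of_mem_closure⟩) heL (fun f _ ↦ hloop f)
      (fun f hf ↦ ((hmemL f).1 hf).1)
    rw [MerinoWelsh, hT, hT, hT]
    exact isMWTriple_add_sum hLcard
  obtain ⟨g, hg, hge⟩ := not_subset.1 hE
  have hge' : g ≠ e := by rintro rfl; exact hge hecl
  obtain ⟨L', hL'⟩ := (M.ground_finite.subset
    (sdiff_subset : M.E \ insert g (M.closure {e}) ⊆ M.E)).exists_finset_coe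
  have hmemL' : ∀ a, a ∈ L' ↔ a ∈ M.E ∧ a ≠ g ∧ a ∉ M.closure {e} := fun a ↦ by
    rw [← Finset.mem_coe, hL']; simp
  have hnecl : ∀ {a}, a ∉ M.closure {e} → a ≠ e := by rintro a h rfl; exact h hecl
  obtain ⟨h, hh, hhg⟩ := hpar g hg
  have hhL' : h ∈ L' := (hmemL' h).2 ⟨mem_ground_of_mem_closure hh, hhg,
    fun h1 ↦ hge (mem_closure_singleton_trans (hsymm hh) h1)⟩
  have hQ : ∀ x y, (M ／ {e} ＼ (L : Set α)).tutteEval x y =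
      x + ∑ i ∈ Finset.range L'.card, y ^ (i + 1) := by
    refine tutteEval_of_isParallelClass (e := g) ?_ (by simp [hmemL']) ?_ ?_
    · ext a
      simp only [delete_ground, contract_ground, mem_sdiff, Finset.mem_coe, mem_insert_iff,
        mem_singleton_iff, hmemL, hmemL']
      by_cases h1 : a = g
      · simp [h1, hg, hge', hge]
      · by_cases h2 : a = e
        · simp [h2, hecl, hge'.symm]
        · simp only [h1, h2, false_or]; tauto
    · intro a ha hal
      have h1 := contract_isLoop_singleton_iff.1 (delete_isLoop_iff.1 hal).1
      exact ha.2 ((hmemL a).2 h1)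
    · intro a ha
      rw [hmemL'] at ha
      have hgL : g ∉ (L : Set α) := fun h ↦ hge ((hmemL g).1 h).1
      rw [delete_closure_eq, sdiff_eq_left.2 (disjoint_singleton_left.2 hgL), contract_closure_eq]
      refine ⟨⟨?_, hnecl ha.2.2⟩, fun h ↦ ha.2.2 ((hmemL a).1 h).1⟩
      rw [singleton_union]
      exact mem_closure_pair_of_forall_parallel hM hloop hpar he hg hge ha.1
  have hT := tutteEval_eq_delete_parallel L M (hnl e he)
    (fun a ha ↦ hnl a (mem_ground_of_mem_closure ((hmemL a).1 ha).1))
    (fun a ha ↦ contract_isLoop_singleton_iff.2 ((hmemL a).1 ha))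
  by_cases hecol : (M ＼ (L : Set α)).IsColoop e
  · have hT' : ∀ x y, M.tutteEval x y = (x + ∑ i ∈ Finset.range L.card, y ^ (i + 1)) *
        (x + ∑ i ∈ Finset.range L'.card, y ^ (i + 1)) := by
      intro x y
      rw [hT, hecol.tutteEval_eq, tutteEval_congr hecol.delete_eq_contract_delete, hQ]
      ring
    rw [MerinoWelsh, hT', hT', hT']
    exact (isMWTriple_add_sum hLcard).mul (isMWTriple_add_sum (Finset.card_pos.2 ⟨h, hhL'⟩))
  have hL'card : 3 ≤ L'.card := by
    have h1 : ∃ a ∈ (M.E \ (L : Set α)) \ {e}, a ∉ M.closure {g} := by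
      by_contra! hcon
      refine hecol ((delete_isColoop_iff _ _).2 ⟨fun h2 ↦ hge (hsymm ?_), he, by simpa using heL⟩)
      exact M.closure_subset_closure_of_subset_closure hcon h2
    obtain ⟨a, ha, hag⟩ := h1
    have hae : a ∉ M.closure {e} := fun h ↦ ha.1.2 ((hmemL a).2 ⟨h, ha.2⟩)
    obtain ⟨b, hb, hba⟩ := hpar a ha.1.1
    have hne1 : a ≠ g := by rintro rfl; exact hag (M.mem_closure_of_mem' rfl hg)
    have hne2 : b ≠ g := by rintro rfl; exact hag (hsymm hb)
    have hne3 : h ≠ a := by rintro rfl; exact hag hh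
    have hne4 : h ≠ b := by rintro rfl; exact hag (mem_closure_singleton_trans (hsymm hb) hh)
    have hbe : b ∉ M.closure {e} := fun h1 ↦ hae (mem_closure_singleton_trans (hsymm hb) h1)
    have hsub : ({h, a, b} : Finset α) ⊆ L' := by
      intro c hc
      simp only [Finset.mem_insert, Finset.mem_singleton] at hc
      rcases hc with rfl | rfl | rfl
      · exact hhL'
      · exact (hmemL' _).2 ⟨ha.1.1, hne1, hae⟩
      · exact (hmemL' _).2 ⟨mem_ground_of_mem_closure hb, hne2, hbe⟩
    have hcard : ({h, a, b} : Finset α).card = 3 :=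
      Finset.card_eq_three.2 ⟨h, a, b, hne3, hne4, hba.symm, rfl⟩
    exact hcard ▸ Finset.card_le_card hsub
  have heq : M ＼ (L : Set α) ＼ {e} = M ＼ M.closure {e} := by
    rw [delete_delete, hL, sdiff_union_of_subset (singleton_subset_iff.2 hecl)]
  have heq' : M ＼ (L : Set α) ／ {e} = M ／ {e} ＼ (L : Set α) :=
    (contract_delete_comm _ (by simpa using heL)).symm
  have hT' : ∀ x y, M.tutteEval x y = (M ＼ M.closure {e}).tutteEval x y +
      (1 + ∑ i ∈ Finset.range L.card, y ^ (i + 1)) *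
        (x + ∑ i ∈ Finset.range L'.card, y ^ (i + 1)) := by
    intro x y
    rw [hT, tutteEval_eq_delete_add_contract (delete_isNonloop_iff.2
      ⟨hnl e he, by simpa using heL⟩) hecol, tutteEval_congr heq, tutteEval_congr heq', hQ]
    ring
  rw [MerinoWelsh, hT', hT', hT']
  refine (ih _ ⟨e, hecl, he⟩ fun a ha ↦ ?_).add (isMWTriple_one_add_sum_mul hLcard hL'card)
  rw [delete_isColoop_iff] at ha
  obtain ⟨b, hb, hba⟩ := hpar a ha.2.1
  refine ha.1 (M.closure_subset_closure (singleton_subset_iff.2 ?_) (hsymm hb))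
  exact ⟨⟨mem_ground_of_mem_closure hb,
    fun h1 ↦ ha.2.2 (mem_closure_singleton_trans (hsymm hb) h1)⟩, hba⟩

/-- An element with a parallel and a series partner lies in a summand of size two. -/
lemma tutteEval_of_parallel_of_series [M.Finite] (hloop : ∀ e, ¬ M.IsLoop e)
    (hcoloop : ∀ e, ¬ M.IsColoop e) (hf : f ∈ M.closure {e}) (hfe : f ≠ e)
    (ht : (M ＼ {e}).IsColoop t) :
    (∀ x y, M.tutteEval x y = (x + y) * (M ＼ {e} ＼ {f}).tutteEval x y) ∧
      ∀ a, ¬ (M ＼ {e} ＼ {f}).IsColoop a := by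
  have hfE := mem_ground_of_mem_closure hf
  have hef : e ∈ M.closure {f} :=
    (isNonloop_of_not_isLoop hfE (hloop f)).mem_closure_singleton hf
  have heE := mem_ground_of_mem_closure hef
  obtain rfl : t = f := by
    by_contra htf
    exact hcoloop t (isColoop_of_isColoop_delete_parallel (singleton_subset_iff.2 hef) hfE hfe ht
      htf)
  have he : (M ＼ {t}).IsColoop e := by
    rw [delete_isColoop_iff] at ht ⊢
    refine ⟨fun h ↦ ht.1 ?_, heE, hfe.symm⟩
    rw [Set.sdiff_sdiff_comm]
    exact M.closure_subset_closure_of_subset_closure (singleton_subset_iff.2 h) hf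
  have hl : (M ／ {e}).IsLoop t := contract_isLoop_singleton_iff.2 ⟨hf, hfe⟩
  have heq : M ／ {e} ＼ {t} = M ＼ {e} ＼ {t} := by
    rw [← he.delete_eq_contract_delete, delete_comm]
  refine ⟨fun x y ↦ ?_, fun a ha ↦ ?_⟩
  · rw [tutteEval_eq_delete_add_contract (isNonloop_of_not_isLoop heE (hloop e)) (hcoloop e),
      ht.tutteEval_eq, hl.tutteEval_eq, tutteEval_congr heq]
    ring
  · rw [← heq, ← contract_eq_delete_of_subset_loops (singleton_subset_iff.2 hl),
      contract_isColoop_iff, contract_isColoop_iff] at ha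
    exact hcoloop a ha.1.1

/-- The Merino-Welsh inequality for matroids without mixed minors. -/
theorem NoMixedMinor.merinoWelsh [M.Finite] (hM : M.NoMixedMinor) (hloop : ∀ e, ¬ M.IsLoop e)
    (hcoloop : ∀ e, ¬ M.IsColoop e) : M.MerinoWelsh := by
  obtain ⟨n, hn⟩ : ∃ n, M.E.ncard = n := ⟨_, rfl⟩
  induction n using Nat.strong_induction_on generalizing M with | _ n ih =>
  subst hn
  have hlt : ∀ {D : Set α}, (D ∩ M.E).Nonempty → (M.E \ D).ncard < M.E.ncard := fun ⟨a, ha⟩ ↦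
    ncard_lt_ncard ((ssubset_iff_of_subset sdiff_subset).2 ⟨a, ha.2, fun h ↦ h.2 ha.1⟩)
      M.ground_finite
  have hdel : ∀ {M : Matroid α}, (∀ e, ¬ M.IsLoop e) → ∀ D e, ¬ (M ＼ D).IsLoop e :=
    fun h D e h' ↦ h e (delete_isLoop_iff.1 h').1
  have hnl : ∀ a ∈ M.E, M.IsNonloop a := fun a ha ↦ isNonloop_of_not_isLoop ha (hloop a)
  rcases M.E.eq_empty_or_nonempty with hE | hne
  · simp only [MerinoWelsh, tutteEval_of_ground_eq_empty hE]
    exact ⟨by norm_num, by norm_num, by norm_num⟩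
  by_cases h1 : ∃ e ∈ M.E, (∀ f ∈ M.closure {e}, f = e) ∧ ∀ t, ¬ (M ＼ {e}).IsColoop t
  · obtain ⟨e, he, hp, hs⟩ := h1
    simp only [MerinoWelsh, tutteEval_eq_delete_add_contract (hnl e he) (hcoloop e)]
    refine IsMWTriple.add
      (ih _ (hlt (D := {e}) ⟨e, rfl, he⟩) (hM.delete {e}) (hdel hloop {e}) hs rfl)
      (ih _ (hlt (D := {e}) ⟨e, rfl, he⟩) (hM.contract {e}) (fun f hf ↦ ?_)
        (fun f hf ↦ hcoloop f (contract_isColoop_iff.1 hf).1) rfl)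
    rw [contract_isLoop_singleton_iff] at hf
    exact hf.2 (hp f hf.1)
  by_cases h2 : ∃ e f t, f ∈ M.closure {e} ∧ f ≠ e ∧ (M ＼ {e}).IsColoop t
  · obtain ⟨e, f, t, hf, hfe, ht⟩ := h2
    have heE := mem_ground_of_mem_closure
      ((hnl f (mem_ground_of_mem_closure hf)).mem_closure_singleton hf)
    obtain ⟨hT, hc⟩ := tutteEval_of_parallel_of_series hloop hcoloop hf hfe ht
    rw [MerinoWelsh, hT, hT, hT]
    refine IsMWTriple.mul ⟨by norm_num, by norm_num, by norm_num⟩ (ih _ ?_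
      ((hM.delete {e}).delete {f}) (hdel (hdel hloop {e}) {f}) hc rfl)
    rw [delete_delete]
    exact hlt ⟨e, by simp, heE⟩
  have h1' : ∀ e ∈ M.E, (∃ f ∈ M.closure {e}, f ≠ e) ∨ ∃ t, (M ＼ {e}).IsColoop t := by
    intro e he
    by_contra! hcon
    exact h1 ⟨e, he, hcon⟩
  have h2' : ∀ {e f t}, f ∈ M.closure {e} → f ≠ e → ¬ (M ＼ {e}).IsColoop t :=
    fun h h' h'' ↦ h2 ⟨_, _, _, h, h', h''⟩
  by_cases hp : ∀ e ∈ M.E, ∃ f ∈ M.closure {e}, f ≠ e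
  · exact merinoWelsh_of_forall_parallel hM hloop hp hne fun D hD hc ↦
      ih _ (hlt hD) (hM.delete D) (hdel hloop D) hc rfl
  by_cases hs : ∀ e ∈ M.E, ∃ t, (M ＼ {e}).IsColoop t
  · refine merinoWelsh_of_dual (merinoWelsh_of_forall_parallel hM.dual hcoloop (fun e he ↦ ?_) hne
      fun D hD hc ↦ ih _ (hlt hD) (hM.dual.delete D) (hdel hcoloop D) hc rfl)
    obtain ⟨t, ht⟩ := hs e he
    rw [← dual_isLoop_iff_isColoop, dual_delete, contract_isLoop_singleton_iff] at ht
    exact ⟨t, ht⟩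
  push Not at hp hs
  obtain ⟨s, hsE, hs'⟩ := hp
  obtain ⟨e, heE, he'⟩ := hs
  obtain ⟨t, ht⟩ := (h1' s hsE).resolve_left fun ⟨f, hf, hfs⟩ ↦ hfs (hs' f hf)
  obtain ⟨f, hf, hfe⟩ := (h1' e heE).resolve_right fun ⟨t, ht⟩ ↦ he' t ht
  have hef := (hnl f (mem_ground_of_mem_closure hf)).mem_closure_singleton hf
  refine merinoWelsh_of_parallel_of_series hM hloop hcoloop hf hfe ht hsE ?_ ?_ ?_
  · rintro rfl; exact he' t ht
  · rintro rfl
    refine he' s ?_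
    have ht' := (delete_isColoop_iff _ _).1 ht
    rw [delete_isColoop_iff]
    refine ⟨fun h ↦ hcoloop e ((isColoop_iff_notMem_closure_compl heE).2 fun h' ↦ ht'.1 ?_), hsE,
      fun h ↦ ht'.2.2 h.symm⟩
    refine M.closure_subset_closure_of_subset_closure (fun a ha ↦ ?_) h'
    by_cases has : a = s
    · rw [has, Set.sdiff_sdiff_comm]
      exact h
    · exact M.mem_closure_of_mem' ⟨⟨ha.1, has⟩, ha.2⟩ ha.1
  · rintro rfl; exact h2' hef hfe.symm ht

lemma merinoWelsh_disjointSigma (n : ℕ) : ∀ (N : Fin n → Matroid α)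
    (hN : Pairwise (Function.onFun Disjoint fun i ↦ (N i).E)) [(Matroid.disjointSigma N hN).Finite],
    (∀ (i) (_ : (N i).Finite), (N i).MerinoWelsh) → (Matroid.disjointSigma N hN).MerinoWelsh := by
  induction n with
  | zero =>
    intro N hN _ _
    simp only [MerinoWelsh, tutteEval_of_ground_eq_empty
      (show (Matroid.disjointSigma N hN).E = ∅ by simp)]
    exact ⟨by norm_num, by norm_num, by norm_num⟩
  | succ n ih =>
    intro N hN _ h
    have hfin : ∀ i, (N i).Finite := fun i ↦ ⟨(Matroid.disjointSigma N hN).ground_finite.subset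
      (by rw [disjointSigma_ground_eq]; exact subset_iUnion (fun i ↦ (N i).E) i)⟩
    have hN' : Pairwise (Function.onFun Disjoint fun i : Fin n ↦ (N i.succ).E) :=
      fun i j hij ↦ hN (fun h ↦ hij (Fin.succ_injective _ h))
    have hd : Disjoint (N 0).E (Matroid.disjointSigma (fun i : Fin n ↦ N i.succ) hN').E := by
      rw [disjointSigma_ground_eq, disjoint_iUnion_right]
      exact fun i ↦ hN (Fin.succ_ne_zero i).symm
    have hU : ⋃ i, (N i).E = (N 0).E ∪ ⋃ i : Fin n, (N i.succ).E := by
      ext a; simp [Fin.exists_fin_succ]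
    have heq : Matroid.disjointSigma N hN = (N 0).disjointSum (Matroid.disjointSigma _ hN') hd := by
      refine ext_indep (by simpa using hU) fun I hI ↦ ?_
      simp only [disjointSigma_ground_eq] at hI
      simp only [disjointSigma_indep_iff, disjointSum_indep_iff, disjointSigma_ground_eq, ← hU, hI,
        and_true, Fin.forall_fin_succ, inter_subset_right]
      refine and_congr_right fun _ ↦ forall_congr' fun i ↦ ?_
      rw [inter_assoc, inter_eq_right.2 (subset_iUnion (fun i : Fin n ↦ (N i.succ).E) i)]
    have h0 := hfin 0
    have hf1 : (Matroid.disjointSigma (fun i : Fin n ↦ N i.succ) hN').Finite :=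
      ⟨by rw [disjointSigma_ground_eq]; exact finite_iUnion fun i ↦ (hfin i.succ).ground_finite⟩
    have hf2 : ((N 0).disjointSum (Matroid.disjointSigma _ hN') hd).Finite := heq ▸ ‹_›
    simp only [MerinoWelsh, tutteEval_congr heq, tutteEval_disjointSum]
    exact (h 0 h0).mul (ih _ hN' fun i hi ↦ h i.succ hi)

theorem IsSplit.merinoWelsh [M.Finite] (hsplit : M.IsSplit)
    (hloop : ∀ e, ¬ M.IsLoop e) (hcoloop : ∀ e, ¬ M.IsColoop e) : M.MerinoWelsh := by
  obtain ⟨n, N, hN, i₀, hi₀, hi, rfl⟩ := hsplit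
  refine merinoWelsh_disjointSigma n N hN fun i _ ↦ NoMixedMinor.merinoWelsh ?_ ?_ ?_
  · by_cases h : i = i₀
    · exact h ▸ hi₀.noMixedMinor
    · exact (hi i h).noMixedMinor
  · intro e he
    have heE : e ∈ (Matroid.disjointSigma N hN).E := by
      rw [disjointSigma_ground_eq]
      exact mem_iUnion.2 ⟨i, he.mem_ground⟩
    have h1 := (isNonloop_of_not_isLoop heE (hloop e)).indep
    rw [disjointSigma_indep_iff] at h1
    have h2 := h1.1 i
    rw [inter_eq_left.2 (singleton_subset_iff.2 he.mem_ground)] at h2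
    exact he.not_isNonloop (indep_singleton.1 h2)
  · intro e he
    refine hcoloop e (isColoop_iff_forall_mem_isBase.2 fun B hB ↦ ?_)
    exact (he.mem_of_isBase ((disjointSigma_isBase_iff.1 hB).1 i)).1

end Matroid

theorem theorem1p3 {α : Type*} (M : Matroid α) [M.Finite] (hsplit : M.IsSplit)
    (hloop : ∀ e, ¬ M.IsLoop e) (hcoloop : ∀ e, ¬ M.IsColoop e) :
    M.tutteEval 2 0 * M.tutteEval 0 2 ≥ M.tutteEval 1 1 ^ 2 ∧
      M.tutteEval 2 0 + M.tutteEval 0 2 ≥ 2 * M.tutteEval 1 1 ∧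
      max (M.tutteEval 2 0) (M.tutteEval 0 2) ≥ M.tutteEval 1 1 := by
  have h := hsplit.merinoWelsh hloop hcoloop
  have h1 := h.two_mul_le
  refine ⟨h.2.2, h1, ?_⟩
  rcases le_total (M.tutteEval 2 0) (M.tutteEval 0 2) with h2 | h2
  · rw [max_eq_right h2]; linarith
  · rw [max_eq_left h2]; linarith
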